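/- Let $\rho_{AB}$ be a real two-qubit state, that is, a positive semidefinite operator of trace one on $\mathbb{C}^2\otimes\mathbb{C}^2$ whose matrix entries in the standard basis are real. For $\theta\in\mathbb{R}$ put $|\theta\rangle=\cos\frac{\theta}{2}|0\rangle+\sin\frac{\theta}{2}|1\rangle$, and let the steering ellipse of $\rho_{AB}$ be the $2\pi$-periodic curve of real Hermitian $2\times 2$ operators $$\tilde\rho_B(\theta)=\mathrm{Tr}_A\left[(|\theta\rangle\langle\theta|\otimes\mathbb{I}_B)\,\rho_{AB}\right].$$ Assume the following. (i) The steering ellipse has tilt $<1$. Here the tilt of a real Hermitian operator $\frac12(n\mathbb{I}+r_1\sigma_1+r_3\sigma_3)$, with $\sigma_1=|0\rangle\langle 1|+|1\rangle\langle 0|$ and $\sigma_3=|0\rangle\langle 0|-|1\rangle\langle 1|$, is $\sqrt{r_1^2+r_3^2}/|n|$ (and $\infty$ if $n=0$). The tilt of the steering ellipse is the tilt of any nonzero real Hermitian operator that is normal, for the inner product $\langle X,Y\rangle=\mathrm{Tr}(X^\dagger Y)$, to the affine space spanned by the ellipse if this space is two-dimensional, and is $\infty$ otherwise. (ii) The steering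 ellipse has a local hidden state model: there are a Borel probability measure $\mu$ on the set $\mathbb{RP}^1$ of one-dimensional real orthogonal projectors on $\mathbb{C}^2$ and measurable functions $f_\theta\colon\mathbb{RP}^1\to[0,1]$, $\theta\in\mathbb{R}$, such that $\tilde\rho_B(\theta)=\int_{\mathbb{RP}^1}x\,f_\theta(x)\,\mathrm{d}\mu(x)$ for all $\theta$. Then the length of the steering ellipse in the trace norm $\|X\|_1=\mathrm{Tr}\sqrt{X^\dagger X}$ is at most $2$: the curve $\tilde\rho_B$ is differentiable, $\theta\mapsto\left\|\frac{\mathrm{d}}{\mathrm{d}\theta}\tilde\rho_B(\theta)\right\|_1$ is integrable on $[0,2\pi]$, and $$\int_0^{2\pi}\left\|\frac{\mathrm{d}}{\mathrm{d}\theta}\tilde\rho_B(\theta)\right\|_1\mathrm{d}\theta\le 2.$$ -/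

import Mathlib

open MeasureTheory Matrix
open scoped ComplexOrder MatrixOrder Kronecker ENNReal

noncomputable section

/-- Operators on one qubit `ℂ²`, as matrices in the standard basis. -/
abbrev QubitOp : Type := Matrix (Fin 2) (Fin 2) ℂ

/-- Operators on two qubits `ℂ² ⊗ ℂ²`; the first index is Alice's, the second is Bob's. -/
abbrev TwoQubitOp : Type := Matrix (Fin 2 × Fin 2) (Fin 2 × Fin 2) ℂ

/-- An operator is real if all its entries in the standard basis are real numbers. -/
def IsRealOp {ι : Type*} (X : Matrix ι ι ℂ) : Prop :=
  ∀ i j, (X i j).im = 0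

/-- Real density operators: positive semidefinite, of trace one, with real entries. -/
def IsRealDensity {ι : Type*} [Fintype ι] (ρ : Matrix ι ι ℂ) : Prop :=
  ρ.PosSemidef ∧ ρ.trace = 1 ∧ IsRealOp ρ

/-- The set of one-dimensional real orthogonal projectors on `ℂ²`. -/
def RP1 : Set QubitOp :=
  {P | P.IsHermitian ∧ P * P = P ∧ P.trace = 1 ∧ IsRealOp P}

/-- `RP1` carries the Borel σ-algebra of the topology inherited from the space of matrices. -/
instance instMeasurableSpaceRP1 : MeasurableSpace RP1 := borel RP1

instance instBorelSpaceRP1 : BorelSpace RP1 := ⟨rfl⟩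

/-- The absolute value is `|X| = √(X† X)`, and the trace norm is `‖X‖₁ = Tr |X|`. -/
def traceNorm (X : QubitOp) : ℝ :=
  (CFC.abs X).trace.re

/-- The Pauli operator `σ₁ = |0⟩⟨1| + |1⟩⟨0|`. -/
def pauli1 : QubitOp := !![0, 1; 1, 0]

/-- The Pauli operator `σ₃ = |0⟩⟨0| - |1⟩⟨1|`. -/
def pauli3 : QubitOp := !![1, 0; 0, -1]

/-- The coordinate `n` of a real Hermitian operator `(n I + r₁ σ₁ + r₃ σ₃) / 2`. -/
def blochN (X : QubitOp) : ℝ := X.trace.re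

/-- The coordinate `r₁` of a real Hermitian operator `(n I + r₁ σ₁ + r₃ σ₃) / 2`. -/
def blochR1 (X : QubitOp) : ℝ := (X * pauli1).trace.re

/-- The coordinate `r₃` of a real Hermitian operator `(n I + r₁ σ₁ + r₃ σ₃) / 2`. -/
def blochR3 (X : QubitOp) : ℝ := (X * pauli3).trace.re

/-- Every real Hermitian operator on `ℂ²` is recovered from its three coordinates. -/
theorem eq_bloch {X : QubitOp} (hX : X.IsHermitian) (hr : IsRealOp X) :
    X = (1 / 2 : ℂ) • ((blochN X : ℂ) • (1 : QubitOp) + (blochR1 X : ℂ) • pauli1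
      + (blochR3 X : ℂ) • pauli3) := by
  have h01 := hX.apply 0 1
  have hre : (X 1 0).re = (X 0 1).re := by
    have := congrArg Complex.re h01
    simpa using this
  ext i j
  have := hr i j
  fin_cases i <;> fin_cases j <;>
    simp_all [blochN, blochR1, blochR3, pauli1, pauli3, Matrix.trace, Fin.sum_univ_two,
      Matrix.mul_apply, Complex.ext_iff] <;> ring

open Classical in
/-- The tilt `√(r₁² + r₃²) / |n|` of a real Hermitian operator, which is `∞` when `n = 0`. -/
def tilt (X : QubitOp) : ℝ≥0∞ :=
  if blochN X = 0 then ⊤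
  else ENNReal.ofReal (Real.sqrt (blochR1 X ^ 2 + blochR3 X ^ 2) / |blochN X|)

/-- The unit vector `|θ⟩ = cos (θ/2) |0⟩ + sin (θ/2) |1⟩`. -/
def ketTheta (θ : ℝ) : Fin 2 → ℂ :=
  ![(Real.cos (θ / 2) : ℂ), (Real.sin (θ / 2) : ℂ)]

/-- The projector `|θ⟩⟨θ|`. -/
def projTheta (θ : ℝ) : QubitOp :=
  Matrix.vecMulVec (ketTheta θ) (star (ketTheta θ))

/-- The partial trace over Alice's qubit. -/
def partialTraceA (M : TwoQubitOp) : QubitOp :=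
  Matrix.of fun i j => ∑ k : Fin 2, M (k, i) (k, j)

/-- The steering ellipse `ρ̃_B(θ) = Tr_A [(|θ⟩⟨θ| ⊗ I) ρ_AB]`. -/
def steeringEllipse (ρ : TwoQubitOp) (θ : ℝ) : QubitOp :=
  partialTraceA ((projTheta θ ⊗ₖ (1 : QubitOp)) * ρ)

/-- `H` is a nonzero real Hermitian operator that is normal, for the inner product
`⟨X, Y⟩ = Tr (X† Y)`, to the affine space spanned by the steering ellipse. -/
def IsNormalToEllipse (ρ : TwoQubitOp) (H : QubitOp) : Prop :=
  H ≠ 0 ∧ H.IsHermitian ∧ IsRealOp H ∧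
    ∀ v ∈ vectorSpan ℝ (Set.range (steeringEllipse ρ)), (Hᴴ * v).trace = 0

open Classical in
/-- The tilt of the steering ellipse. If the ellipse spans a two-dimensional affine space, then
its normal vectors in the three-dimensional space of real Hermitian operators are the nonzero
multiples of one of them, so they all have the same tilt and the infimum is this common value
(see `tilt_eq_ellipseTilt`). If the ellipse is degenerate, the tilt is `∞`. -/
def ellipseTilt (ρ : TwoQubitOp) : ℝ≥0∞ :=
  if Module.finrank ℝ (vectorSpan ℝ (Set.range (steeringEllipse ρ))) = 2 then
    ⨅ (H : QubitOp) (_ : IsNormalToEllipse ρ H), tilt H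
  else ⊤

theorem steeringEllipse_apply (ρ : TwoQubitOp) (θ : ℝ) (i j : Fin 2) :
    steeringEllipse ρ θ i j = ∑ k : Fin 2, ∑ l : Fin 2, projTheta θ k l * ρ (l, i) (k, j) := by
  simp only [steeringEllipse, partialTraceA, Matrix.of_apply]
  refine Finset.sum_congr rfl fun k _ => ?_
  rw [Matrix.mul_apply, Fintype.sum_prod_type]
  refine Finset.sum_congr rfl fun l _ => ?_
  simp [Matrix.kroneckerMap_apply, Matrix.one_apply]

theorem steeringEllipse_isRealOp {ρ : TwoQubitOp} (hr : IsRealOp ρ) (θ : ℝ) :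
    IsRealOp (steeringEllipse ρ θ) := by
  intro i j
  have h1 : ∀ k l, (projTheta θ k l).im = 0 := by
    intro k l
    rw [projTheta, Matrix.vecMulVec_apply, Pi.star_apply]
    fin_cases k <;> fin_cases l <;> simp [ketTheta, -Complex.ofReal_cos, -Complex.ofReal_sin]
  rw [steeringEllipse_apply]
  simp [Fin.sum_univ_two, h1, hr _ _]

theorem steeringEllipse_isHermitian {ρ : TwoQubitOp} (hh : ρ.IsHermitian) (θ : ℝ) :
    (steeringEllipse ρ θ).IsHermitian := by
  ext i j
  have h1 : ∀ k l, star (projTheta θ k l) = projTheta θ l k := by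
    intro k l
    simp [projTheta, Matrix.vecMulVec_apply, mul_comm]
  rw [Matrix.conjTranspose_apply, steeringEllipse_apply, steeringEllipse_apply, star_sum,
    Finset.sum_comm]
  simp only [star_sum, star_mul', h1, hh.apply]

/-- The coordinates `(n, r₁, r₃)` as a vector of three-dimensional Euclidean space. -/
def blochVec : QubitOp →ₗ[ℝ] EuclideanSpace ℝ (Fin 3) where
  toFun X := !₂[blochN X, blochR1 X, blochR3 X]
  map_add' X Y := by
    ext i; fin_cases i <;> simp [blochN, blochR1, blochR3, add_mul]
  map_smul' c X := by
    ext i; fin_cases i <;> simp [blochN, blochR1, blochR3]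

theorem trace_mul_eq_inner_blochVec {X Y : QubitOp} (hX : X.IsHermitian) (hXr : IsRealOp X)
    (hY : Y.IsHermitian) (hYr : IsRealOp Y) :
    (Xᴴ * Y).trace = ((inner ℝ (blochVec X) (blochVec Y) / 2 : ℝ) : ℂ) := by
  have h : inner ℝ (blochVec X) (blochVec Y) = blochN X * blochN Y + blochR1 X * blochR1 Y
      + blochR3 X * blochR3 Y := by
    simp [blochVec, PiLp.inner_apply, Fin.sum_univ_three]
    ring
  rw [h, hX.eq]
  conv_lhs => rw [eq_bloch hX hXr, eq_bloch hY hYr]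
  generalize blochN X = a
  generalize blochR1 X = b
  generalize blochR3 X = c
  generalize blochN Y = a'
  generalize blochR1 Y = b'
  generalize blochR3 Y = c'
  simp [pauli1, pauli3, Matrix.trace, Fin.sum_univ_two, Matrix.mul_apply, Matrix.one_apply]
  ring

theorem eq_of_blochVec_eq {X Y : QubitOp} (hX : X.IsHermitian) (hXr : IsRealOp X)
    (hY : Y.IsHermitian) (hYr : IsRealOp Y) (h : blochVec X = blochVec Y) : X = Y := by
  have h0 : blochN X = blochN Y := by simpa [blochVec] using congrArg (fun v => v 0) h
  have h1 : blochR1 X = blochR1 Y := by simpa [blochVec] using congrArg (fun v => v 1) h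
  have h3 : blochR3 X = blochR3 Y := by simpa [blochVec] using congrArg (fun v => v 2) h
  rw [eq_bloch hX hXr, eq_bloch hY hYr, h0, h1, h3]

theorem isHermitian_isRealOp_of_mem_vectorSpan {ρ : TwoQubitOp} (hh : ρ.IsHermitian)
    (hr : IsRealOp ρ) {v : QubitOp}
    (hv : v ∈ vectorSpan ℝ (Set.range (steeringEllipse ρ))) : v.IsHermitian ∧ IsRealOp v := by
  rw [vectorSpan_def] at hv
  induction hv using Submodule.span_induction with
  | mem x hx =>
    obtain ⟨_, ⟨s, rfl⟩, _, ⟨t, rfl⟩, rfl⟩ := hx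
    refine ⟨(steeringEllipse_isHermitian hh s).sub (steeringEllipse_isHermitian hh t), ?_⟩
    intro i j
    simp [steeringEllipse_isRealOp hr s i j, steeringEllipse_isRealOp hr t i j]
  | zero => exact ⟨Matrix.isHermitian_zero, fun i j => by simp⟩
  | add x y _ _ hx hy =>
    exact ⟨hx.1.add hy.1, fun i j => by simp [hx.2 i j, hy.2 i j]⟩
  | smul a x _ hx =>
    refine ⟨?_, fun i j => by simp [hx.2 i j]⟩
    ext i j
    have := hx.1.apply i j
    simp only [Matrix.conjTranspose_apply, Matrix.smul_apply, star_smul, this]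
    simp

theorem tilt_smul {X : QubitOp} {c : ℝ} (hc : c ≠ 0) : tilt (c • X) = tilt X := by
  have h0 : blochN (c • X) = c * blochN X := by simp [blochN]
  have h1 : blochR1 (c • X) = c * blochR1 X := by simp [blochR1]
  have h3 : blochR3 (c • X) = c * blochR3 X := by simp [blochR3]
  unfold tilt
  rw [h0, h1, h3]
  by_cases h : blochN X = 0
  · simp [h]
  · rw [if_neg (mul_ne_zero hc h), if_neg h]
    congr 1
    rw [show (c * blochR1 X) ^ 2 + (c * blochR3 X) ^ 2
      = c ^ 2 * (blochR1 X ^ 2 + blochR3 X ^ 2) by ring, Real.sqrt_mul (sq_nonneg c),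
      Real.sqrt_sq_eq_abs, abs_mul]
    exact mul_div_mul_left _ _ (abs_ne_zero.mpr hc)

theorem exists_smul_eq_of_isNormalToEllipse {ρ : TwoQubitOp} (hρ : IsRealDensity ρ)
    (hdim : Module.finrank ℝ (vectorSpan ℝ (Set.range (steeringEllipse ρ))) = 2)
    {H K : QubitOp} (hH : IsNormalToEllipse ρ H) (hK : IsNormalToEllipse ρ K) :
    ∃ c : ℝ, c ≠ 0 ∧ c • H = K := by
  obtain ⟨hρ1, -, hρ3⟩ := hρ
  set V := vectorSpan ℝ (Set.range (steeringEllipse ρ)) with hV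
  have hmem : ∀ v ∈ V, v.IsHermitian ∧ IsRealOp v := fun v hv =>
    isHermitian_isRealOp_of_mem_vectorSpan hρ1.1 hρ3 hv
  have hinj : Function.Injective (blochVec.domRestrict V) := by
    intro x y hxy
    exact Subtype.ext (eq_of_blochVec_eq (hmem _ x.2).1 (hmem _ x.2).2 (hmem _ y.2).1
      (hmem _ y.2).2 hxy)
  have hW : Module.finrank ℝ (V.map blochVec) = 2 := by
    have h := LinearMap.finrank_range_of_inj hinj
    rwa [LinearMap.range_domRestrict, hdim] at h
  have hWo : Module.finrank ℝ (V.map blochVec)ᗮ = 1 := by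
    have := Submodule.finrank_add_finrank_orthogonal (V.map blochVec)
    rw [hW, finrank_euclideanSpace_fin] at this
    omega
  have horth : ∀ {L : QubitOp}, IsNormalToEllipse ρ L → blochVec L ∈ (V.map blochVec)ᗮ := by
    intro L hL
    rw [Submodule.mem_orthogonal']
    rintro _ ⟨v, hv, rfl⟩
    have h := hL.2.2.2 v hv
    rw [trace_mul_eq_inner_blochVec hL.2.1 hL.2.2.1 (hmem v hv).1 (hmem v hv).2] at h
    have h' := Complex.ofReal_eq_zero.mp h
    linarith
  have hz : IsRealOp (0 : QubitOp) := fun i j => by simp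
  have hne : (⟨blochVec H, horth hH⟩ : (V.map blochVec)ᗮ) ≠ 0 := by
    intro h
    refine hH.1 (eq_of_blochVec_eq hH.2.1 hH.2.2.1 Matrix.isHermitian_zero hz ?_)
    simpa using congrArg Subtype.val h
  obtain ⟨c, hc⟩ := (finrank_eq_one_iff_of_nonzero' _ hne).mp hWo ⟨blochVec K, horth hK⟩
  have hc' : c • blochVec H = blochVec K := congrArg Subtype.val hc
  have hcH : (c • H).IsHermitian := by
    ext i j
    have := hH.2.1.apply i j
    simp only [Matrix.conjTranspose_apply, Matrix.smul_apply, star_smul, this]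
    simp
  have hcr : IsRealOp (c • H) := fun i j => by simp [hH.2.2.1 i j]
  have hcK : c • H = K :=
    eq_of_blochVec_eq hcH hcr hK.2.1 hK.2.2.1 (by rw [map_smul, hc'])
  refine ⟨c, ?_, hcK⟩
  rintro rfl
  exact hK.1 (by rw [← hcK, zero_smul])

/-- If the steering ellipse is not degenerate, its tilt is that of any of its normal vectors. -/
theorem tilt_eq_ellipseTilt {ρ : TwoQubitOp} (hρ : IsRealDensity ρ)
    (hdim : Module.finrank ℝ (vectorSpan ℝ (Set.range (steeringEllipse ρ))) = 2)
    {H : QubitOp} (hH : IsNormalToEllipse ρ H) : tilt H = ellipseTilt ρ := by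
  rw [ellipseTilt, if_pos hdim]
  refine le_antisymm (le_iInf₂ fun K hK => ?_) (iInf₂_le H hH)
  obtain ⟨c, hc, rfl⟩ := exists_smul_eq_of_isNormalToEllipse hρ hdim hH hK
  rw [tilt_smul hc]

/-- A family `σ` of subnormalized one-qubit states has a local hidden state model if there are
a probability distribution `μ` on `RP1` and response functions `f a : RP1 → [0, 1]` such that
`σ a = ∫ x, f a x • x ∂μ` for all `a`. The integral of the (bounded, measurable) matrix-valued
function is taken entry by entry. -/
def HasLHSModel {ι : Type*} (σ : ι → QubitOp) : Prop :=
  ∃ (μ : Measure RP1) (f : ι → RP1 → ℝ), IsProbabilityMeasure μ ∧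
    ∀ a, Measurable (f a) ∧ (∀ x, f a x ∈ Set.Icc (0 : ℝ) 1) ∧
      σ a = Matrix.of fun i j => ∫ x : RP1, (f a x : ℂ) * (x : QubitOp) i j ∂μ

/-- The derivative of a curve of operators, entry by entry. -/
def curveDeriv (S : ℝ → QubitOp) (t : ℝ) : QubitOp :=
  Matrix.of fun i j => deriv (fun s => S s i j) t

/-- The length in trace norm of a curve of operators with parameter interval `[a, b]`. -/
def traceNormLength (S : ℝ → QubitOp) (a b : ℝ) : ℝ :=
  ∫ t in a..b, traceNorm (curveDeriv S t)

end

/-! A normal vector of tilt below one forces every tangent vector of the ellipse to satisfy `|n| ≤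
√(r₁² + r₃²)`. Its eigenvalues `(n ± √(r₁² + r₃²)) / 2` then do not have the same strict sign, and
its trace norm is `√(r₁² + r₃²)`. The trace-norm length is therefore the Euclidean length of the
ellipse projected to the Bloch plane `(r₃, r₁)` (`traceNorm_curveDeriv_steeringEllipse`).

By Crofton's formula (`integral_ellipse_speed`) this length is the integral over directions `φ ∈ [0,
2π]` of half the width of the projected ellipse. In a local hidden state model the width in
direction `φ` is at most the `μ`-average of `|⟨x, e_φ⟩|`, where `x` stands for its unit Bloch vector
(`width_le_integral`). Each unit vector contributes `∫ |cos| = 4` over all directions, so the length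
is at most `4 / 2 = 2`. -/

/-! ### Trigonometric polynomials of degree one: mean absolute value and amplitude. -/

theorem integral_abs_cos_period : ∫ t in (0 : ℝ)..2 * Real.pi, |Real.cos t| = 4 := by
  have hi : ∀ a b : ℝ, IntervalIntegrable (fun t => |Real.cos t|) volume a b := fun a b =>
    (Real.continuous_cos.abs).intervalIntegrable a b
  have hper : Function.Periodic (fun t => |Real.cos t|) Real.pi := fun t => by
    simp [Real.cos_add_pi]
  have hhalf : ∀ a : ℝ, ∫ t in a..a + Real.pi, |Real.cos t| = 2 := by
    intro a
    rw [hper.intervalIntegral_add_eq a (-(Real.pi / 2)),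
      show -(Real.pi / 2) + Real.pi = Real.pi / 2 by ring]
    have : ∫ t in (-(Real.pi / 2))..(Real.pi / 2), |Real.cos t|
        = ∫ t in (-(Real.pi / 2))..(Real.pi / 2), Real.cos t := by
      refine intervalIntegral.integral_congr fun t ht => ?_
      rw [Set.uIcc_of_le (by linarith [Real.pi_pos])] at ht
      exact abs_of_nonneg (Real.cos_nonneg_of_mem_Icc ht)
    rw [this, integral_cos]
    simp
    norm_num
  rw [← intervalIntegral.integral_add_adjacent_intervals (hi 0 (0 + Real.pi)) (hi (0 + Real.pi) (2 * Real.pi)),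
    show 2 * Real.pi = (0 + Real.pi) + Real.pi by ring, hhalf, hhalf]
  norm_num

theorem exists_polar (x y : ℝ) :
    ∃ δ : ℝ, x = Real.sqrt (x ^ 2 + y ^ 2) * Real.cos δ ∧
      y = Real.sqrt (x ^ 2 + y ^ 2) * Real.sin δ := by
  have h : ‖(⟨x, y⟩ : ℂ)‖ = Real.sqrt (x ^ 2 + y ^ 2) := by
    rw [Complex.norm_def, Complex.normSq_mk, sq, sq]
  refine ⟨Complex.arg ⟨x, y⟩, ?_, ?_⟩
  · rw [← h, Complex.norm_mul_cos_arg]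
  · rw [← h, Complex.norm_mul_sin_arg]

/-- In polar form the integrand is the amplitude times a shifted `|cos|`. This evaluates both
iterated integrals in Crofton's formula and also the average over directions for a single hidden
state. -/
theorem integral_abs_cos_sin (x y : ℝ) :
    ∫ t in (0 : ℝ)..2 * Real.pi, |x * Real.cos t + y * Real.sin t|
      = 4 * Real.sqrt (x ^ 2 + y ^ 2) := by
  obtain ⟨δ, hx, hy⟩ := exists_polar x y
  have hR := Real.sqrt_nonneg (x ^ 2 + y ^ 2)
  have hfun : ∀ t, |x * Real.cos t + y * Real.sin t|
      = Real.sqrt (x ^ 2 + y ^ 2) * |Real.cos (t - δ)| := by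
    intro t
    generalize Real.sqrt (x ^ 2 + y ^ 2) = R at hx hy hR ⊢
    rw [← abs_of_nonneg hR, ← abs_mul, Real.cos_sub, hx, hy]
    congr 1
    ring
  have hper : Function.Periodic (fun t => |Real.cos t|) (2 * Real.pi) := fun t => by simp
  simp_rw [hfun]
  rw [intervalIntegral.integral_const_mul,
    intervalIntegral.integral_comp_sub_right (fun t => |Real.cos t|) δ,
    show 2 * Real.pi - δ = (0 - δ) + 2 * Real.pi by ring,
    hper.intervalIntegral_add_eq (0 - δ) 0, zero_add, integral_abs_cos_period]
  ring

/-- The oscillation of a trigonometric polynomial of degree one bounds its amplitude. -/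
theorem two_mul_sqrt_le_of_osc_le {c x y M : ℝ}
    (h : ∀ s t, (c + x * Real.cos s + y * Real.sin s) - (c + x * Real.cos t + y * Real.sin t) ≤ M) :
    2 * Real.sqrt (x ^ 2 + y ^ 2) ≤ M := by
  obtain ⟨δ, hx, hy⟩ := exists_polar x y
  -- The maximum is at the polar angle `δ` of `(x, y)` and the minimum at the opposite point.
  have h1 := h δ (δ + Real.pi)
  rw [Real.cos_add_pi, Real.sin_add_pi] at h1
  set R := Real.sqrt (x ^ 2 + y ^ 2)
  have : R * (Real.cos δ ^ 2 + Real.sin δ ^ 2) = R := by rw [Real.cos_sq_add_sin_sq, mul_one]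
  rw [hx, hy] at h1
  linarith

/-! ### Trace norm in Bloch coordinates. -/

/-- The trace norm of a `2 × 2` matrix through its Hilbert-Schmidt norm and its determinant. -/
theorem traceNorm_sq (X : QubitOp) :
    traceNorm X ^ 2 = (Xᴴ * X).trace.re + 2 * ‖X.det‖ := by
  have hA : (CFC.abs X).PosSemidef := Matrix.nonneg_iff_posSemidef.mp (CFC.abs_nonneg X)
  have hsq : CFC.abs X * CFC.abs X = Xᴴ * X := CFC.abs_mul_abs X
  have hd := hA.det_nonneg
  have ht := hA.trace_nonneg
  have hdet : (CFC.abs X).det.re = ‖X.det‖ := by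
    have h := congrArg Matrix.det hsq
    rw [Matrix.det_mul, Matrix.det_mul, Matrix.det_conjTranspose] at h
    have h2 := congrArg norm h
    rw [norm_mul, norm_mul, norm_star] at h2
    have h3 : ‖(CFC.abs X).det‖ = ‖X.det‖ := by
      nlinarith [norm_nonneg (CFC.abs X).det, norm_nonneg X.det]
    rw [← h3, Complex.re_eq_norm]
    exact hd
  have hre : ((CFC.abs X).trace ^ 2).re = (CFC.abs X).trace.re ^ 2 := by
    have := (Complex.nonneg_iff.mp ht).2
    rw [sq, Complex.mul_re, ← this]
    ring
  rw [traceNorm, ← hdet, ← hsq, ← hre]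
  -- What remains is `(Tr M)² = Tr M² + 2 det M` for a `2 × 2` matrix, with `M = |X|`.
  simp only [Matrix.trace_fin_two, Matrix.det_fin_two, Matrix.mul_apply, Fin.sum_univ_two,
    Complex.add_re, Complex.sub_re, Complex.mul_re, Complex.add_im, sq]
  ring

theorem traceNorm_nonneg (X : QubitOp) : 0 ≤ traceNorm X :=
  (Complex.nonneg_iff.mp (Matrix.nonneg_iff_posSemidef.mp (CFC.abs_nonneg X)).trace_nonneg).1

/-- Here `det X = (n² - r₁² - r₃²) / 4 ≤ 0`, so the terms in `n²` cancel in `Tr X² + 2 |det X|`. -/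
theorem traceNorm_eq_sqrt_of_abs_blochN_le {X : QubitOp} (hX : X.IsHermitian) (hr : IsRealOp X)
    (h : blochN X ^ 2 ≤ blochR1 X ^ 2 + blochR3 X ^ 2) :
    traceNorm X = Real.sqrt (blochR1 X ^ 2 + blochR3 X ^ 2) := by
  have h1 := traceNorm_sq X
  have hn : blochN X ^ 2 + (blochR1 X ^ 2 + blochR3 X ^ 2) = 2 * (Xᴴ * X).trace.re := by
    rw [trace_mul_eq_inner_blochVec hX hr hX hr, Complex.ofReal_re, real_inner_self_eq_norm_sq,
      EuclideanSpace.real_norm_sq_eq]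
    simp [blochVec, Fin.sum_univ_three]
    ring
  have hd : X.det
      = (((blochN X ^ 2 - (blochR1 X ^ 2 + blochR3 X ^ 2)) / 4 : ℝ) : ℂ) := by
    conv_lhs => rw [eq_bloch hX hr]
    generalize blochN X = a
    generalize blochR1 X = b
    generalize blochR3 X = c
    simp [pauli1, pauli3, Matrix.det_fin_two]
    ring
  rw [hd, Complex.norm_real, Real.norm_eq_abs, abs_of_nonpos (by linarith)] at h1
  rw [show blochR1 X ^ 2 + blochR3 X ^ 2 = traceNorm X ^ 2 by rw [h1]; linarith,
    Real.sqrt_sq (traceNorm_nonneg X)]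

/-! ### The steering ellipse, its derivative and its tilt. -/

/-- By the half-angle formulas `|θ⟩⟨θ| = (I + cos θ σ₃ + sin θ σ₁) / 2`, and the ellipse depends
linearly on this projector. -/
theorem exists_steeringEllipse_eq (ρ : TwoQubitOp) :
    ∃ A B C : QubitOp, ∀ θ : ℝ, steeringEllipse ρ θ
      = A + Real.cos θ • B + Real.sin θ • C := by
  refine ⟨Matrix.of fun i j => (ρ (0, i) (0, j) + ρ (1, i) (1, j)) / 2,
    Matrix.of fun i j => (ρ (0, i) (0, j) - ρ (1, i) (1, j)) / 2,
    Matrix.of fun i j => (ρ (1, i) (0, j) + ρ (0, i) (1, j)) / 2, fun θ => ?_⟩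
  ext i j
  have hc : ((Real.cos (θ / 2) : ℝ) : ℂ) * (Real.cos (θ / 2) : ℝ) = (1 + (Real.cos θ : ℝ)) / 2 := by
    have : Real.cos (θ / 2) * Real.cos (θ / 2) = (1 + Real.cos θ) / 2 := by
      rw [← sq, Real.cos_sq, mul_div_cancel₀ θ two_ne_zero]; ring
    exact_mod_cast this
  have hs : ((Real.sin (θ / 2) : ℝ) : ℂ) * (Real.sin (θ / 2) : ℝ) = (1 - (Real.cos θ : ℝ)) / 2 := by
    have : Real.sin (θ / 2) * Real.sin (θ / 2) = (1 - Real.cos θ) / 2 := by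
      rw [← sq, Real.sin_sq, Real.cos_sq, mul_div_cancel₀ θ two_ne_zero]; ring
    exact_mod_cast this
  have hsc : ((Real.cos (θ / 2) : ℝ) : ℂ) * (Real.sin (θ / 2) : ℝ) = (Real.sin θ : ℝ) / 2 := by
    have : Real.cos (θ / 2) * Real.sin (θ / 2) = Real.sin θ / 2 := by
      have := Real.sin_two_mul (θ / 2)
      rw [mul_div_cancel₀ θ two_ne_zero] at this
      linarith
    exact_mod_cast this
  rw [steeringEllipse_apply]
  simp only [Fin.sum_univ_two, projTheta, Matrix.vecMulVec_apply, ketTheta, Pi.star_apply,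
    Matrix.cons_val_zero, Matrix.cons_val_one, Complex.star_def, Complex.conj_ofReal,
    Matrix.add_apply, Matrix.smul_apply, Matrix.of_apply, Complex.real_smul]
  rw [mul_comm ((Real.sin (θ / 2) : ℝ) : ℂ) (Real.cos (θ / 2) : ℝ), hc, hs, hsc]
  ring

/-- A quarter-period shift differentiates `cos` and `sin`, and the difference removes the constant
term. Written as a difference of two points of the curve, the derivative visibly lies in its
`vectorSpan`. -/
theorem hasDerivAt_steeringEllipse (ρ : TwoQubitOp) (θ : ℝ) (i j : Fin 2) :
    HasDerivAt (fun t : ℝ => steeringEllipse ρ t i j)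
      (((1 / 2 : ℝ) • (steeringEllipse ρ (θ + Real.pi / 2)
        - steeringEllipse ρ (θ - Real.pi / 2))) i j) θ := by
  obtain ⟨A, B, C, h⟩ := exists_steeringEllipse_eq ρ
  have h1 : HasDerivAt (fun t : ℝ => A i j + Real.cos t • B i j + Real.sin t • C i j)
      (-Real.sin θ • B i j + Real.cos θ • C i j) θ :=
    (((Real.hasDerivAt_cos θ).smul_const (B i j)).const_add (A i j)).add
      ((Real.hasDerivAt_sin θ).smul_const (C i j))
  simp only [h, Matrix.add_apply, Matrix.smul_apply, Matrix.sub_apply]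
  convert h1 using 1
  rw [Real.cos_add_pi_div_two, Real.sin_add_pi_div_two, Real.cos_sub_pi_div_two,
    Real.sin_sub_pi_div_two]
  module

theorem curveDeriv_steeringEllipse (ρ : TwoQubitOp) (θ : ℝ) :
    curveDeriv (steeringEllipse ρ) θ = (1 / 2 : ℝ) • (steeringEllipse ρ (θ + Real.pi / 2)
        - steeringEllipse ρ (θ - Real.pi / 2)) := by
  ext i j
  exact (hasDerivAt_steeringEllipse ρ θ i j).deriv

theorem curveDeriv_steeringEllipse_mem (ρ : TwoQubitOp) (θ : ℝ) :
    curveDeriv (steeringEllipse ρ) θ ∈ vectorSpan ℝ (Set.range (steeringEllipse ρ)) := by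
  rw [curveDeriv_steeringEllipse]
  exact Submodule.smul_mem _ _ (vsub_mem_vectorSpan ℝ ⟨_, rfl⟩ ⟨_, rfl⟩)

/-- An ellipse of tilt less than one has a normal vector of tilt less than one. -/
theorem exists_isNormalToEllipse_tilt_lt_one {ρ : TwoQubitOp} (h : ellipseTilt ρ < 1) :
    ∃ H, IsNormalToEllipse ρ H ∧ blochR1 H ^ 2 + blochR3 H ^ 2 < blochN H ^ 2 := by
  unfold ellipseTilt at h
  split_ifs at h with hdim
  · simp only [iInf_lt_iff] at h
    obtain ⟨H, hH, hlt⟩ := h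
    refine ⟨H, hH, ?_⟩
    unfold tilt at hlt
    split_ifs at hlt with h0
    · simp at hlt
    · rw [← ENNReal.ofReal_one, ENNReal.ofReal_lt_ofReal_iff one_pos,
        div_lt_one (abs_pos.mpr h0), Real.sqrt_lt' (abs_pos.mpr h0), sq_abs] at hlt
      exact hlt
  · simp at h

/-- For a tangent `(n, r, s)` and a normal `(a, b, c)`, orthogonality gives `n a = -(r b + s c)`.
Cauchy-Schwarz and `b² + c² < a²` then yield `n² ≤ r² + s²`. -/
theorem traceNorm_curveDeriv_steeringEllipse {ρ : TwoQubitOp} (hρ : IsRealDensity ρ)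
    (h : ellipseTilt ρ < 1) (θ : ℝ) :
    traceNorm (curveDeriv (steeringEllipse ρ) θ)
      = Real.sqrt (blochR1 (curveDeriv (steeringEllipse ρ) θ) ^ 2
        + blochR3 (curveDeriv (steeringEllipse ρ) θ) ^ 2) := by
  have hmem := curveDeriv_steeringEllipse_mem ρ θ
  obtain ⟨hH, hR⟩ := isHermitian_isRealOp_of_mem_vectorSpan hρ.1.1 hρ.2.2 hmem
  obtain ⟨K, hK, hlt⟩ := exists_isNormalToEllipse_tilt_lt_one h
  refine traceNorm_eq_sqrt_of_abs_blochN_le hH hR ?_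
  have horth := hK.2.2.2 _ hmem
  rw [trace_mul_eq_inner_blochVec hK.2.1 hK.2.2.1 hH hR, Complex.ofReal_eq_zero] at horth
  simp [blochVec, PiLp.inner_apply, Fin.sum_univ_three] at horth
  generalize blochN (curveDeriv (steeringEllipse ρ) θ) = n at *
  generalize blochR1 (curveDeriv (steeringEllipse ρ) θ) = r at *
  generalize blochR3 (curveDeriv (steeringEllipse ρ) θ) = s at *
  generalize blochN K = a at *
  generalize blochR1 K = b at *
  generalize blochR3 K = c at *
  have ha : 0 < a ^ 2 := lt_of_le_of_lt (by positivity) hlt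
  have h1 : (n * a) ^ 2 = (r * b + s * c) ^ 2 := by
    rw [show n * a = -(r * b + s * c) by linarith]
    ring
  have h2 : (r * b + s * c) ^ 2 ≤ (r ^ 2 + s ^ 2) * (b ^ 2 + c ^ 2) := by
    nlinarith [sq_nonneg (r * c - s * b)]
  have h3 : (r ^ 2 + s ^ 2) * (b ^ 2 + c ^ 2) ≤ (r ^ 2 + s ^ 2) * a ^ 2 :=
    mul_le_mul_of_nonneg_left hlt.le (by positivity)
  refine le_of_mul_le_mul_right ?_ ha
  linarith [mul_pow n a 2]

/-! ### Hidden states as unit vectors, and the width bound. -/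

/-- A projector of trace one has `n = 1`, and `Tr P² = 1` reads `n² + r₁² + r₃² = 2`. -/
theorem blochR1_sq_add_blochR3_sq_of_mem_RP1 (x : RP1) :
    blochR1 (x : QubitOp) ^ 2 + blochR3 (x : QubitOp) ^ 2 = 1 := by
  obtain ⟨P, hP, hPP, ht, hr⟩ := x
  have h1 := trace_mul_eq_inner_blochVec hP hr hP hr
  rw [hP.eq, hPP, ht] at h1
  have h2 : inner ℝ (blochVec P) (blochVec P) = 2 := by
    have := congrArg Complex.re h1
    rw [Complex.ofReal_re, Complex.one_re] at this
    linarith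
  have hn : blochN P = 1 := by simp [blochN, ht]
  rw [real_inner_self_eq_norm_sq, EuclideanSpace.real_norm_sq_eq] at h2
  simp [blochVec, Fin.sum_univ_three, hn] at h2
  simp only
  linarith

theorem continuous_blochR1_coe : Continuous fun x : RP1 => blochR1 (x : QubitOp) := by
  unfold blochR1
  fun_prop

theorem continuous_blochR3_coe : Continuous fun x : RP1 => blochR3 (x : QubitOp) := by
  unfold blochR3
  fun_prop

theorem abs_re_apply_le_one_of_mem_RP1 (x : RP1) (i j : Fin 2) :
    |((x : QubitOp) i j).re| ≤ 1 := by
  obtain ⟨P, hP, hPP, ht, hr⟩ := x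
  -- The diagonal of `P² = P` bounds each squared entry of a row by the diagonal entry, which is
  -- then itself at most one.
  have h1 : P i 0 * P 0 i + P i 1 * P 1 i = P i i := by
    rw [← Fin.sum_univ_two (fun k => P i k * P k i), ← Matrix.mul_apply, hPP]
  have h2 : ∀ k, (P k i).re = (P i k).re := fun k => by
    rw [← hP.apply k i]; simp
  have h2' : ∀ k l, (P k l).im = 0 := hr
  have h3 := congrArg Complex.re h1
  simp only [Complex.add_re, Complex.mul_re, h2', h2 0, h2 1, mul_zero, sub_zero] at h3
  have h4 : ∀ k, (P i k).re * (P i k).re ≤ (P i i).re := fun k => by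
    fin_cases k
    · change (P i 0).re * (P i 0).re ≤ _
      linarith [mul_self_nonneg (P i 1).re]
    · change (P i 1).re * (P i 1).re ≤ _
      linarith [mul_self_nonneg (P i 0).re]
  have h5 : (P i i).re ≤ 1 := by nlinarith [h4 i]
  exact (abs_le_one_iff_mul_self_le_one).mpr ((h4 j).trans h5)

theorem re_integral_mul_apply {μ : Measure RP1} (f : RP1 → ℝ) (i j : Fin 2) :
    (∫ x : RP1, (f x : ℂ) * (x : QubitOp) i j ∂μ).re
      = ∫ x : RP1, f x * ((x : QubitOp) i j).re ∂μ := by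
  have : ∀ x : RP1, (f x : ℂ) * (x : QubitOp) i j
      = ((f x * ((x : QubitOp) i j).re : ℝ) : ℂ) := fun x => by
    apply Complex.ext <;> simp [x.2.2.2.2 i j]
  rw [integral_congr_ae (.of_forall this)]
  exact (congrArg Complex.re integral_ofReal).trans (Complex.ofReal_re _)

section

variable {μ : Measure RP1} [IsProbabilityMeasure μ] {f : RP1 → ℝ}

theorem integrable_mul_of_abs_le_one {g : RP1 → ℝ} (hf : Measurable f)
    (hf1 : ∀ x, f x ∈ Set.Icc (0 : ℝ) 1) (hg : Measurable g) (hg1 : ∀ x, |g x| ≤ 1) :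
    Integrable (fun x => f x * g x) μ := by
  refine Integrable.of_bound (hf.mul hg).aestronglyMeasurable 1 (.of_forall fun x => ?_)
  rw [Real.norm_eq_abs, abs_mul, abs_of_nonneg (hf1 x).1]
  exact mul_le_one₀ (hf1 x).2 (abs_nonneg _) (hg1 x)

theorem integrable_mul_re_apply (hf : Measurable f) (hf1 : ∀ x, f x ∈ Set.Icc (0 : ℝ) 1)
    (i j : Fin 2) : Integrable (fun x : RP1 => f x * ((x : QubitOp) i j).re) μ := by
  have : Continuous fun x : RP1 => ((x : QubitOp) i j).re :=
    Complex.continuous_re.comp (continuous_subtype_val.matrix_elem i j)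
  exact integrable_mul_of_abs_le_one hf hf1 this.measurable
    fun x => abs_re_apply_le_one_of_mem_RP1 x i j

theorem blochR1_of_integral (hf : Measurable f) (hf1 : ∀ x, f x ∈ Set.Icc (0 : ℝ) 1) :
    blochR1 (Matrix.of fun i j => ∫ x : RP1, (f x : ℂ) * (x : QubitOp) i j ∂μ)
      = ∫ x : RP1, f x * blochR1 (x : QubitOp) ∂μ := by
  have h : ∀ X : QubitOp, blochR1 X = (X 0 1).re + (X 1 0).re := fun X => by
    simp [blochR1, pauli1, Matrix.trace_fin_two, Matrix.mul_apply]
  simp only [h, Matrix.of_apply, re_integral_mul_apply, mul_add]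
  rw [integral_add (integrable_mul_re_apply hf hf1 0 1) (integrable_mul_re_apply hf hf1 1 0)]

theorem blochR3_of_integral (hf : Measurable f) (hf1 : ∀ x, f x ∈ Set.Icc (0 : ℝ) 1) :
    blochR3 (Matrix.of fun i j => ∫ x : RP1, (f x : ℂ) * (x : QubitOp) i j ∂μ)
      = ∫ x : RP1, f x * blochR3 (x : QubitOp) ∂μ := by
  have h : ∀ X : QubitOp, blochR3 X = (X 0 0).re - (X 1 1).re := fun X => by
    simp [blochR3, pauli3, Matrix.trace_fin_two, Matrix.mul_apply]
    ring
  simp only [h, Matrix.of_apply, re_integral_mul_apply, mul_sub]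
  rw [integral_sub (integrable_mul_re_apply hf hf1 0 0) (integrable_mul_re_apply hf hf1 1 1)]

end

theorem abs_blochR_comb_le_one (x : RP1) (φ : ℝ) :
    |blochR3 (x : QubitOp) * Real.cos φ + blochR1 (x : QubitOp) * Real.sin φ| ≤ 1 := by
  rw [abs_le_one_iff_mul_self_le_one]
  have h := blochR1_sq_add_blochR3_sq_of_mem_RP1 x
  have h' := Real.cos_sq_add_sin_sq φ
  have : (blochR1 (x : QubitOp) ^ 2 + blochR3 (x : QubitOp) ^ 2)
      * (Real.cos φ ^ 2 + Real.sin φ ^ 2) = 1 := by rw [h, h', one_mul]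
  nlinarith [sq_nonneg (blochR3 (x : QubitOp) * Real.sin φ - blochR1 (x : QubitOp) * Real.cos φ)]

/-- In every direction, the set of operators `∫ f x • x ∂μ` has width at most the integral of the
widths of its generating segments. -/
theorem width_le_integral {S : ℝ → QubitOp} {μ : Measure RP1} [IsProbabilityMeasure μ]
    {f : ℝ → RP1 → ℝ}
    (h : ∀ a, Measurable (f a) ∧ (∀ x, f a x ∈ Set.Icc (0 : ℝ) 1) ∧
      S a = Matrix.of fun i j => ∫ x : RP1, (f a x : ℂ) * (x : QubitOp) i j ∂μ) (φ s t : ℝ) :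
    (blochR3 (S s) * Real.cos φ + blochR1 (S s) * Real.sin φ)
      - (blochR3 (S t) * Real.cos φ + blochR1 (S t) * Real.sin φ)
      ≤ ∫ x : RP1, |blochR3 (x : QubitOp) * Real.cos φ + blochR1 (x : QubitOp) * Real.sin φ| ∂μ := by
  set g : RP1 → ℝ := fun x =>
    blochR3 (x : QubitOp) * Real.cos φ + blochR1 (x : QubitOp) * Real.sin φ with hg
  have hgc : Continuous g :=
    (continuous_blochR3_coe.mul continuous_const).add (continuous_blochR1_coe.mul continuous_const)
  have hg1 : ∀ x, |g x| ≤ 1 := fun x => abs_blochR_comb_le_one x φ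
  have hint : ∀ a, Integrable (fun x => f a x * g x) μ := fun a =>
    integrable_mul_of_abs_le_one (h a).1 (h a).2.1 hgc.measurable hg1
  have hu1 : ∀ x : RP1, |blochR1 (x : QubitOp)| ≤ 1 := fun x => by
    simpa using abs_blochR_comb_le_one x (Real.pi / 2)
  have hu3 : ∀ x : RP1, |blochR3 (x : QubitOp)| ≤ 1 := fun x => by
    simpa using abs_blochR_comb_le_one x 0
  have hval : ∀ a, blochR3 (S a) * Real.cos φ + blochR1 (S a) * Real.sin φ
      = ∫ x, f a x * g x ∂μ := by
    intro a
    obtain ⟨hm, hb, hS⟩ := h a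
    rw [hS, blochR3_of_integral hm hb, blochR1_of_integral hm hb, ← integral_mul_const,
      ← integral_mul_const, ← integral_add]
    · refine integral_congr_ae (.of_forall fun x => ?_)
      simp only [hg]
      ring
    · exact (integrable_mul_of_abs_le_one hm hb continuous_blochR3_coe.measurable hu3).mul_const _
    · exact (integrable_mul_of_abs_le_one hm hb continuous_blochR1_coe.measurable hu1).mul_const _
  rw [hval, hval, ← integral_sub (hint s) (hint t)]
  refine integral_mono ((hint s).sub (hint t)) ?_ fun x => ?_
  · refine Integrable.of_bound hgc.abs.measurable.aestronglyMeasurable 1 (.of_forall fun x => ?_)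
    simpa using hg1 x
  · have hs := (h s).2.1 x
    have ht := (h t).2.1 x
    change f s x * g x - f t x * g x ≤ |g x|
    rw [← sub_mul]
    -- Two response values in `[0, 1]` differ by at most one.
    refine (le_abs_self _).trans ?_
    rw [abs_mul]
    refine mul_le_of_le_one_left (abs_nonneg _) ?_
    rw [abs_le]
    constructor <;> linarith [hs.1, hs.2, ht.1, ht.2]

/-- After exchanging the integrals, each `x` contributes four times the length of its Bloch vector,
which is one. -/
theorem integral_integral_abs_blochR_comb (μ : Measure RP1) [IsProbabilityMeasure μ] :
    ∫ φ in (0 : ℝ)..2 * Real.pi, ∫ x : RP1,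
      |blochR3 (x : QubitOp) * Real.cos φ + blochR1 (x : QubitOp) * Real.sin φ| ∂μ = 4 := by
  have hc : Continuous (Function.uncurry fun (φ : ℝ) (x : RP1) =>
      |blochR3 (x : QubitOp) * Real.cos φ + blochR1 (x : QubitOp) * Real.sin φ|) := by
    have h1 := continuous_blochR1_coe
    have h3 := continuous_blochR3_coe
    simp only [Function.uncurry_def]
    exact (((h3.comp continuous_snd).mul (Real.continuous_cos.comp continuous_fst)).add
      ((h1.comp continuous_snd).mul (Real.continuous_sin.comp continuous_fst))).abs
  rw [intervalIntegral_integral_swap]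
  · simp_rw [integral_abs_cos_sin, add_comm (blochR3 _ ^ 2),
      blochR1_sq_add_blochR3_sq_of_mem_RP1]
    simp
  · have : IsFiniteMeasure (volume.restrict (Set.uIoc (0 : ℝ) (2 * Real.pi))) :=
      ⟨by simp [Set.uIoc]⟩
    refine Integrable.of_bound hc.measurable.aestronglyMeasurable 1 (.of_forall fun p => ?_)
    exact (abs_abs _).trans_le (abs_blochR_comb_le_one p.2 p.1)

/-! ### Crofton's formula and the conclusion. -/

/-- Crofton's formula for the length of the ellipse
`t ↦ (a + x cos t + y sin t, a' + x' cos t + y' sin t)`. -/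
theorem integral_ellipse_speed (x y x' y' : ℝ) :
    ∫ t in (0 : ℝ)..2 * Real.pi,
      Real.sqrt ((y * Real.cos t - x * Real.sin t) ^ 2 + (y' * Real.cos t - x' * Real.sin t) ^ 2)
      = ∫ φ in (0 : ℝ)..2 * Real.pi, Real.sqrt ((x * Real.cos φ + x' * Real.sin φ) ^ 2
        + (y * Real.cos φ + y' * Real.sin φ) ^ 2) := by
  have hc : Continuous (Function.uncurry fun t φ : ℝ => |(y * Real.cos t - x * Real.sin t)
      * Real.cos φ + (y' * Real.cos t - x' * Real.sin t) * Real.sin φ|) := by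
    simp only [Function.uncurry_def]
    fun_prop
  -- The double integral of `|⟨γ'(t), e_φ⟩|`: integrating over `φ` gives four times the speed at
  -- `t`, and integrating over `t` gives four times the amplitude in direction `φ`.
  have hswap : ∫ t in (0 : ℝ)..2 * Real.pi, ∫ φ in (0 : ℝ)..2 * Real.pi,
      |(y * Real.cos t - x * Real.sin t) * Real.cos φ
        + (y' * Real.cos t - x' * Real.sin t) * Real.sin φ|
      = ∫ φ in (0 : ℝ)..2 * Real.pi, ∫ t in (0 : ℝ)..2 * Real.pi,
      |(y * Real.cos φ + y' * Real.sin φ) * Real.cos t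
        + -(x * Real.cos φ + x' * Real.sin φ) * Real.sin t| := by
    have hint : IntegrableOn _ (Set.uIoc 0 (2 * Real.pi) ×ˢ Set.uIoc 0 (2 * Real.pi)) :=
      (hc.continuousOn.integrableOn_compact (isCompact_uIcc.prod isCompact_uIcc)).mono_set
        (Set.prod_mono Set.uIoc_subset_uIcc Set.uIoc_subset_uIcc)
    rw [intervalIntegral_intervalIntegral_swap hint]
    refine intervalIntegral.integral_congr fun φ _ => intervalIntegral.integral_congr fun t _ => ?_
    congr 1
    ring
  simp_rw [integral_abs_cos_sin, intervalIntegral.integral_const_mul, neg_sq] at hswap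
  simp_rw [add_comm ((y * Real.cos _ + y' * Real.sin _) ^ 2)] at hswap
  linarith

theorem proposition2 (ρ : TwoQubitOp) (hρ : IsRealDensity ρ)
    (htilt : ellipseTilt ρ < 1)
    (hlhs : HasLHSModel (fun θ : ℝ => steeringEllipse ρ θ)) :
    (∀ i j, Differentiable ℝ (fun θ : ℝ => steeringEllipse ρ θ i j)) ∧
      IntervalIntegrable (fun θ : ℝ => traceNorm (curveDeriv (steeringEllipse ρ) θ))
        volume 0 (2 * Real.pi) ∧
      traceNormLength (steeringEllipse ρ) 0 (2 * Real.pi) ≤ 2 := by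
  obtain ⟨A, B, C, hABC⟩ := exists_steeringEllipse_eq ρ
  have hR1 : ∀ θ, blochR1 (steeringEllipse ρ θ)
      = blochR1 A + blochR1 B * Real.cos θ + blochR1 C * Real.sin θ := fun θ => by
    rw [hABC]
    simp [blochR1, add_mul, mul_comm, -Complex.ofReal_cos, -Complex.ofReal_sin]
  have hR3 : ∀ θ, blochR3 (steeringEllipse ρ θ)
      = blochR3 A + blochR3 B * Real.cos θ + blochR3 C * Real.sin θ := fun θ => by
    rw [hABC]
    simp [blochR3, add_mul, mul_comm, -Complex.ofReal_cos, -Complex.ofReal_sin]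
  have hD1 : ∀ θ, blochR1 (curveDeriv (steeringEllipse ρ) θ)
      = blochR1 C * Real.cos θ - blochR1 B * Real.sin θ := fun θ => by
    have : ∀ X Y : QubitOp, blochR1 ((1 / 2 : ℝ) • (X - Y)) = (blochR1 X - blochR1 Y) / 2 :=
      fun X Y => by simp [blochR1, sub_mul]; ring
    rw [curveDeriv_steeringEllipse, this, hR1, hR1, Real.cos_add_pi_div_two,
      Real.sin_add_pi_div_two, Real.cos_sub_pi_div_two, Real.sin_sub_pi_div_two]
    ring
  have hD3 : ∀ θ, blochR3 (curveDeriv (steeringEllipse ρ) θ)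
      = blochR3 C * Real.cos θ - blochR3 B * Real.sin θ := fun θ => by
    have : ∀ X Y : QubitOp, blochR3 ((1 / 2 : ℝ) • (X - Y)) = (blochR3 X - blochR3 Y) / 2 :=
      fun X Y => by simp [blochR3, sub_mul]; ring
    rw [curveDeriv_steeringEllipse, this, hR3, hR3, Real.cos_add_pi_div_two,
      Real.sin_add_pi_div_two, Real.cos_sub_pi_div_two, Real.sin_sub_pi_div_two]
    ring
  have hspeed : (fun θ => traceNorm (curveDeriv (steeringEllipse ρ) θ)) = fun θ =>
      Real.sqrt ((blochR3 C * Real.cos θ - blochR3 B * Real.sin θ) ^ 2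
        + (blochR1 C * Real.cos θ - blochR1 B * Real.sin θ) ^ 2) := by
    funext θ
    rw [traceNorm_curveDeriv_steeringEllipse hρ htilt, hD1, hD3, add_comm]
  refine ⟨fun i j θ => (hasDerivAt_steeringEllipse ρ θ i j).differentiableAt, ?_, ?_⟩
  · rw [hspeed]
    exact Continuous.intervalIntegrable (by fun_prop) _ _
  obtain ⟨μ, f, hμ, hf⟩ := hlhs
  -- The factor `1 / 2` appears because the amplitude is half the oscillation.
  have hwidth : ∀ φ : ℝ, Real.sqrt ((blochR3 B * Real.cos φ + blochR1 B * Real.sin φ) ^ 2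
        + (blochR3 C * Real.cos φ + blochR1 C * Real.sin φ) ^ 2)
      ≤ 1 / 2 * ∫ x : RP1,
        |blochR3 (x : QubitOp) * Real.cos φ + blochR1 (x : QubitOp) * Real.sin φ| ∂μ := by
    intro φ
    have := two_mul_sqrt_le_of_osc_le
      (c := blochR3 A * Real.cos φ + blochR1 A * Real.sin φ)
      (x := blochR3 B * Real.cos φ + blochR1 B * Real.sin φ)
      (y := blochR3 C * Real.cos φ + blochR1 C * Real.sin φ) (fun s t => by
        have := width_le_integral hf φ s t
        simp only [hR1, hR3] at this
        refine le_trans (le_of_eq ?_) this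
        ring)
    linarith
  rw [traceNormLength, hspeed, integral_ellipse_speed]
  calc _ ≤ ∫ φ in (0 : ℝ)..2 * Real.pi, 1 / 2 * ∫ x : RP1,
        |blochR3 (x : QubitOp) * Real.cos φ + blochR1 (x : QubitOp) * Real.sin φ| ∂μ := by
        refine intervalIntegral.integral_mono_on (by positivity)
          (Continuous.intervalIntegrable (by fun_prop) _ _) ?_ fun φ _ => hwidth φ
        refine IntervalIntegrable.const_mul ?_ _
        -- A function that is not integrable has integral `0` by convention, so the value `4`
        -- already proves integrability.
        exact intervalIntegral.intervalIntegrable_of_integral_ne_zero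
          (by rw [integral_integral_abs_blochR_comb]; norm_num)
    _ = 2 := by
        rw [intervalIntegral.integral_const_mul, integral_integral_abs_blochR_comb]
        norm_num
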